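/- All vector spaces are over $\mathbb{C}$. A Leibniz algebra is a vector space $L$ with a bilinear bracket satisfying $[x,[y,z]]=[[x,y],z]-[[x,z],y]$; its nilradical is its maximal nilpotent two-sided ideal. In multiplication tables, omitted products are zero. For $n\ge 6$ let $g^2_{(n,1)}$ be the $n$-dimensional Lie algebra with basis $e_1,\dots,e_n$ and $$[e_1,e_i]=-[e_i,e_1]=e_{i+1}\ (2\le i\le n-2),\qquad [e_i,e_n]=-[e_n,e_i]=e_{i+2}\ (2\le i\le n-3).$$ **Theorem.** Let $n\ge 6$ and let $R$ be a solvable Leibniz algebra whose nilradical $N$ is isomorphic to $g^2_{(n,1)}$ and has a one-dimensional complementary subspace in $R$. Then $R$ admits a basis $\{e_1,\dots,e_n,x\}$ in which the products $[e_i,e_j]$ are those of $g^2_{(n,1)}$ above and the remaining products are given by one of the following tables, for some complex values of the parameters: * $R_1(b_4,\dots,b_{n-1})$: $\ [e_i,x]=-[x,e_i]=e_i+\sum_{t=i+2}^{n-1}b_{t-i+2}e_t$ for $2\le i\le n-1$; * $R_2(a_2)$: $\ [e_1,x]=-[x,e_1]=e_1+a_2e_2$, $\ [e_i,x]=-[x,e_i]=(i-1)e_i$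 for $2\le i\le n-1$, $\ [e_n,x]=-[x,e_n]=-a_2e_3+2e_n$; * $R_3(\gamma_{n-1})$: $\ [e_1,x]=-[x,e_1]=e_1$, $\ [e_i,x]=-[x,e_i]=(i+3-n)e_i$ for $2\le i\le n-1$, $\ [e_n,x]=-[x,e_n]=\gamma_{n-1}e_{n-1}+2e_n$; * $R_4(\delta_{n-1})$: $\ [e_1,x]=-[x,e_1]=e_1$, $\ [e_i,x]=-[x,e_i]=(i+1-n)e_i$ for $2\le i\le n-1$, $\ [e_n,x]=-[x,e_n]=2e_n$, $\ [x,x]=\delta_{n-1}e_{n-1}$; * $R_5(b_2)$ with $b_2\notin\{1,\,5-n,\,3-n\}$: $\ [e_1,x]=-[x,e_1]=e_1$, $\ [e_i,x]=-[x,e_i]=(i-2+b_2)e_i$ for $2\le i\le n-1$, $\ [e_n,x]=-[x,e_n]=2e_n$. -/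

import Mathlib

/-- A (right) Leibniz algebra over `ℂ`: a complex vector space with a bilinear bracket satisfying
`[x, [y, z]] = [[x, y], z] - [[x, z], y]`. -/
class LeibnizAlgebra (L : Type*) [AddCommGroup L] [Module ℂ L] where
  /-- The bilinear bracket `[x, y] = bracket x y`. -/
  bracket : L →ₗ[ℂ] L →ₗ[ℂ] L
  leibniz : ∀ x y z : L,
    bracket x (bracket y z) = bracket (bracket x y) z - bracket (bracket x z) y

namespace LeibnizAlgebra

/-- Two-sided ideals. -/
def IsIdeal {L : Type*} [AddCommGroup L] [Module ℂ L] [LeibnizAlgebra L]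
    (I : Submodule ℂ L) : Prop :=
  ∀ a ∈ I, ∀ y : L, bracket a y ∈ I ∧ bracket y a ∈ I

/-- `[I, J]`, the span of all `[a, b]` with `a ∈ I`, `b ∈ J`. -/
def bracketSpan {L : Type*} [AddCommGroup L] [Module ℂ L] [LeibnizAlgebra L]
    (I J : Submodule ℂ L) : Submodule ℂ L :=
  Submodule.map₂ bracket I J

/-- The lower central series of `I`, regarded as an algebra in its own right
(index shifted by one: `lowerCentral I 0 = I`). -/
def lowerCentral {L : Type*} [AddCommGroup L] [Module ℂ L] [LeibnizAlgebra L]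
    (I : Submodule ℂ L) : ℕ → Submodule ℂ L
  | 0 => I
  | k + 1 => bracketSpan (lowerCentral I k) I

/-- The derived series of `I` (index shifted by one: `derived I 0 = I`). -/
def derived {L : Type*} [AddCommGroup L] [Module ℂ L] [LeibnizAlgebra L]
    (I : Submodule ℂ L) : ℕ → Submodule ℂ L
  | 0 => I
  | k + 1 => bracketSpan (derived I k) (derived I k)

/-- `I` is nilpotent as an algebra. -/
def Nilpotent {L : Type*} [AddCommGroup L] [Module ℂ L] [LeibnizAlgebra L]
    (I : Submodule ℂ L) : Prop :=
  ∃ k, lowerCentral I k = ⊥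

/-- The Leibniz algebra `L` is solvable. -/
def Solvable (L : Type*) [AddCommGroup L] [Module ℂ L] [LeibnizAlgebra L] : Prop :=
  ∃ k, derived (⊤ : Submodule ℂ L) k = ⊥

/-- `N` is the nilradical: the maximal nilpotent (two-sided) ideal. -/
def IsNilradical {L : Type*} [AddCommGroup L] [Module ℂ L] [LeibnizAlgebra L]
    (N : Submodule ℂ L) : Prop :=
  Maximal (fun I : Submodule ℂ L => IsIdeal I ∧ Nilpotent I) N

/-- Turns a family `v` indexed by `Fin n` into `e_1, …, e_n` with `e_i = v (i - 1)`
(and `e_i = 0` for all other `i`). -/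
def oneIndexed {L : Type*} [AddCommGroup L] {n : ℕ} (v : Fin n → L) (i : ℕ) : L :=
  if h : 1 ≤ i ∧ i ≤ n then v ⟨i - 1, by omega⟩ else 0

/-- The products of `e_1, …, e_n` are those of the Lie algebra `g²_{(n,1)}`:
`[e_1, e_i] = -[e_i, e_1] = e_{i+1}` for `2 ≤ i ≤ n - 2`,
`[e_i, e_n] = -[e_n, e_i] = e_{i+2}` for `2 ≤ i ≤ n - 3`, all others being zero. -/
def G2Table {L : Type*} [AddCommGroup L] [Module ℂ L] [LeibnizAlgebra L]
    (n : ℕ) (e : ℕ → L) : Prop :=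
  ∀ i ∈ Finset.Icc 1 n, ∀ j ∈ Finset.Icc 1 n,
    bracket (e i) (e j) =
      if i = 1 ∧ 2 ≤ j ∧ j + 2 ≤ n then e (j + 1)
      else if j = 1 ∧ 2 ≤ i ∧ i + 2 ≤ n then -e (i + 1)
      else if j = n ∧ 2 ≤ i ∧ i + 3 ≤ n then e (i + 2)
      else if i = n ∧ 2 ≤ j ∧ j + 3 ≤ n then -e (j + 2)
      else 0

/-- `N`, with the bracket of the ambient algebra, is (isomorphic to) `g²_{(n,1)}`. -/
def IsG2 {L : Type*} [AddCommGroup L] [Module ℂ L] [LeibnizAlgebra L]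
    (n : ℕ) (N : Submodule ℂ L) : Prop :=
  ∃ v : Module.Basis (Fin n) ℂ N, G2Table n (oneIndexed fun k => (v k : L))

/-- The products involving `x` are `[e_i, x] = -[x, e_i] = d i` and `[x, x] = q`; the products of
the `e_i` are those of `g²_{(n,1)}`. -/
def ExtensionTable {L : Type*} [AddCommGroup L] [Module ℂ L] [LeibnizAlgebra L]
    (n : ℕ) (e : ℕ → L) (x : L) (d : ℕ → L) (q : L) : Prop :=
  G2Table n e ∧
  (∀ i ∈ Finset.Icc 1 n, bracket (e i) x = d i ∧ bracket x (e i) = -d i) ∧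
  bracket x x = q

/-- The table `R_1(g²_{(n,1)}, 1)(b_4, …, b_{n-1})`. -/
def R1Table {L : Type*} [AddCommGroup L] [Module ℂ L] [LeibnizAlgebra L]
    (n : ℕ) (b : ℕ → ℂ) (e : ℕ → L) (x : L) : Prop :=
  ExtensionTable n e x
    (fun i => if 2 ≤ i ∧ i + 1 ≤ n then
        e i + ∑ t ∈ Finset.Icc (i + 2) (n - 1), b (t - i + 2) • e t
      else 0) 0

/-- The table `R_2(g²_{(n,1)}, 1)(a_2)`. -/
def R2Table {L : Type*} [AddCommGroup L] [Module ℂ L] [LeibnizAlgebra L]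
    (n : ℕ) (a₂ : ℂ) (e : ℕ → L) (x : L) : Prop :=
  ExtensionTable n e x
    (fun i => if i = 1 then e 1 + a₂ • e 2
      else if i = n then -(a₂ • e 3) + (2 : ℂ) • e n
      else ((i : ℂ) - 1) • e i) 0

/-- The table `R_3(g²_{(n,1)}, 1)(γ_{n-1})`. -/
def R3Table {L : Type*} [AddCommGroup L] [Module ℂ L] [LeibnizAlgebra L]
    (n : ℕ) (γ : ℂ) (e : ℕ → L) (x : L) : Prop :=
  ExtensionTable n e x
    (fun i => if i = 1 then e 1
      else if i = n then γ • e (n - 1) + (2 : ℂ) • e n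
      else ((i : ℂ) + 3 - n) • e i) 0

/-- The table `R_4(g²_{(n,1)}, 1)(δ_{n-1})`. -/
def R4Table {L : Type*} [AddCommGroup L] [Module ℂ L] [LeibnizAlgebra L]
    (n : ℕ) (δ : ℂ) (e : ℕ → L) (x : L) : Prop :=
  ExtensionTable n e x
    (fun i => if i = 1 then e 1
      else if i = n then (2 : ℂ) • e n
      else ((i : ℂ) + 1 - n) • e i) (δ • e (n - 1))

/-- The table of `R_5(g²_{(n,1)}, 1)(b_2)`. -/
def R5Table {L : Type*} [AddCommGroup L] [Module ℂ L] [LeibnizAlgebra L]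
    (n : ℕ) (b₂ : ℂ) (e : ℕ → L) (x : L) : Prop :=
  ExtensionTable n e x
    (fun i => if i = 1 then e 1
      else if i = n then (2 : ℂ) • e n
      else ((i : ℂ) - 2 + b₂) • e i) 0

end LeibnizAlgebra

/-!
The span `V` of `e_2, …, e_{n-1}` is abelian; on it `T = [e_1, ·]` is a nilpotent shift and `e_n`
acts through `T²`. Right multiplication by `x` is a derivation of `N`, hence determined by its
values `a e_1 + v` at `e_1`, `b e_2 + z` at `e_2` and `2a e_n - T v + γ e_{n-1}` at `e_n`, with
`v, z ∈ V`; on `V` it is triangular with eigenvalues `b, b + a, …, b + (n - 3) a`.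

Left multiplication by `x` is handled through the elements `[x, y] + [y, x]` and `[x, x]`: they are
annihilated by all left multiplications, and within `N` only the multiples of `e_{n-1}` are
annihilated by left multiplication with elements of `N`. Left multiplication by `x` itself then
gives `[x, y] = -[y, x]` for `y ∈ N` unless `a = b = 0`, in which case `R` would be nilpotent; it
also gives `[x, x] = 0` unless the eigenvalue `b + (n - 3) a` on `e_{n-1}` vanishes.

For `a = 0` one scales to `b = 1`; everything but `z` can be removed (`R_1`). For `a ≠ 0` one
scales to `a = 1` and removes `z`, `v` and `γ`, where each equation to be solved is diagonal up to
nilpotent terms. A parameter survives exactly at a resonance: the `e_2`-component of `v` for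
`b = 1` (`R_2`), `γ` for `b = 5 - n` (`R_3`), `[x, x]` for `b = 3 - n` (`R_4`).
-/

section SpanTail

/-- The span of `f k, f (k + 1), …`. For a basis `f` of a space these are the members of the flag
with respect to which a triangular endomorphism is triangular. -/
def spanTail (K : Type*) {M : Type*} [Semiring K] [AddCommMonoid M] [Module K M] (f : ℕ → M)
    (k : ℕ) : Submodule K M :=
  Submodule.span K (f '' Set.Ici k)

namespace spanTail

section Semiring

variable {K M M' : Type*} [Semiring K] [AddCommMonoid M] [Module K M] [AddCommMonoid M']
  [Module K M'] {f : ℕ → M} {k : ℕ}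

theorem le_iff {P : Submodule K M} : spanTail K f k ≤ P ↔ ∀ j, k ≤ j → f j ∈ P := by
  simp [spanTail, Submodule.span_le, Set.subset_def]

theorem apply_mem {j : ℕ} (h : k ≤ j) : f j ∈ spanTail K f k :=
  Submodule.subset_span ⟨j, h, rfl⟩

theorem antitone (f : ℕ → M) : Antitone (spanTail K f) :=
  fun _ _ h => le_iff.2 fun _ hi => apply_mem (h.trans hi)

theorem eq_bot (hf : ∀ j, k ≤ j → f j = 0) : spanTail K f k = ⊥ :=
  le_bot_iff.1 (le_iff.2 fun j hj => (Submodule.mem_bot K).2 (hf j hj))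

theorem map_mem {P : Submodule K M'} {g : M →ₗ[K] M'} (h : ∀ j, k ≤ j → g (f j) ∈ P) {y : M}
    (hy : y ∈ spanTail K f k) : g y ∈ P :=
  (le_iff (P := P.comap g)).2 h hy

theorem map_eq_map {g g' : M →ₗ[K] M'} (h : ∀ j, k ≤ j → g (f j) = g' (f j)) {y : M}
    (hy : y ∈ spanTail K f k) : g y = g' y :=
  (le_iff (P := LinearMap.eqLocus g g')).2 h hy

theorem eq_span_sup (f : ℕ → M) (k : ℕ) :
    spanTail K f k = Submodule.span K {f k} ⊔ spanTail K f (k + 1) := by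
  rw [spanTail, spanTail, ← Submodule.span_union, ← Set.image_singleton, ← Set.image_union,
    Set.singleton_union, ← Order.succ_eq_add_one, Order.Ici_succ, Set.Ioi_insert]

theorem exists_smul_add {y : M} (hy : y ∈ spanTail K f k) :
    ∃ c : K, ∃ y' ∈ spanTail K f (k + 1), y = c • f k + y' := by
  rw [eq_span_sup, Submodule.mem_sup] at hy
  obtain ⟨_, hc, y', hy', rfl⟩ := hy
  obtain ⟨c, rfl⟩ := Submodule.mem_span_singleton.1 hc
  exact ⟨c, y', hy', rfl⟩

variable {l : ℕ} (hf : ∀ j, l < j → f j = 0)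
include hf

theorem exists_eq_sum {y : M} (hy : y ∈ spanTail K f k) :
    ∃ c : ℕ → K, y = ∑ t ∈ Finset.Icc k l, c t • f t := by
  have hle : spanTail K f k ≤ Submodule.span K (f '' ↑(Finset.Icc k l)) := le_iff.2 fun j hj => by
    by_cases hjl : j ≤ l
    · exact Submodule.subset_span ⟨j, by simp [hj, hjl], rfl⟩
    · simp [hf j (by omega)]
  obtain ⟨c, rfl⟩ := (Submodule.mem_span_image_finset_iff_exists_fun K).1 (hle hy)
  refine ⟨Function.extend Subtype.val c 0, ?_⟩
  rw [← Finset.sum_coe_sort (Finset.Icc k l)]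
  simp only [Subtype.val_injective.extend_apply]

theorem le_of_antitone {P : ℕ → Submodule K M} (hP : Antitone P)
    (h : ∀ j, k ≤ j → spanTail K f (j + 1) ≤ P (j + 1) → f j ∈ P j) : spanTail K f k ≤ P k := by
  suffices H : ∀ d j, k ≤ j → l < j + d → spanTail K f j ≤ P j from H (l + 1) k le_rfl (by omega)
  intro d
  induction d with
  | zero =>
    intro j _ hlj
    rw [eq_bot fun i hi => hf i (by omega)]
    exact bot_le
  | succ d ih =>
    intro j hkj hlj
    have hsucc := ih (j + 1) (by omega) (by omega)
    rw [eq_span_sup]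
    exact sup_le ((Submodule.span_singleton_le_iff_mem _ _).2 (h j hkj hsucc))
      (hsucc.trans (hP j.le_succ))

end Semiring

theorem eq_of_sub_mem {K M : Type*} [Ring K] [AddCommGroup M] [Module K M] {f g : ℕ → M} {l : ℕ}
    (hf : ∀ j, l < j → f j = 0) (h : ∀ j, g j - f j ∈ spanTail K f (j + 1)) (k : ℕ) :
    spanTail K g k = spanTail K f k := by
  refine le_antisymm (le_iff.2 fun j hj => ?_)
    (le_of_antitone hf (antitone g) fun j _ hj => ?_)
  · rw [← sub_add_cancel (g j) (f j)]
    exact add_mem (antitone f (by omega) (h j)) (apply_mem hj)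
  · rw [← sub_sub_cancel (g j) (f j)]
    exact sub_mem (apply_mem le_rfl) (antitone g j.le_succ (hj (h j)))

theorem le_map_of_triangular {K M : Type*} [DivisionRing K] [AddCommGroup M] [Module K M]
    {f : ℕ → M} {k l : ℕ} (hf : ∀ j, l < j → f j = 0) {E : M →ₗ[K] M} {μ : ℕ → K}
    (hμ : ∀ j, k ≤ j → μ j ≠ 0) (hE : ∀ j, k ≤ j → E (f j) - μ j • f j ∈ spanTail K f (j + 1)) :
    spanTail K f k ≤ (spanTail K f k).map E := by
  refine le_of_antitone (P := fun j => (spanTail K f j).map E) hf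
    (fun _ _ h => Submodule.map_mono (antitone f h)) fun j hkj hj => ?_
  rw [← Submodule.smul_mem_iff _ (hμ j hkj), ← sub_sub_cancel (E (f j)) (μ j • f j)]
  exact sub_mem (Submodule.mem_map_of_mem (apply_mem le_rfl))
    (Submodule.map_mono (antitone f j.le_succ) (hj (hE j hkj)))

end spanTail

end SpanTail

theorem exists_eq_smul_add_of_isCoatom {K V : Type*} [DivisionRing K] [AddCommGroup V]
    [Module K V] {N : Submodule K V} (hN : IsCoatom N) {x : V}
    (hx : x ∉ N) (r : V) : ∃ c : K, ∃ y ∈ N, r = c • x + y := by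
  obtain ⟨y, hy, w, hw, rfl⟩ := Submodule.mem_sup.1
    ((Submodule.isCompl_span_singleton_of_isCoatom_of_notMem hN hx).sup_eq_top ▸
      Submodule.mem_top : r ∈ N ⊔ Submodule.span K {x})
  obtain ⟨c, rfl⟩ := Submodule.mem_span_singleton.1 hw
  exact ⟨c, y, hy, add_comm _ _⟩

namespace LeibnizAlgebra

section Leibniz

variable {L : Type*} [AddCommGroup L] [Module ℂ L] [LeibnizAlgebra L]

theorem bracket_bracket_right (y z x : L) :
    bracket (bracket y z) x = bracket (bracket y x) z + bracket y (bracket z x) := by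
  rw [leibniz y z x]
  abel

theorem bracket_bracket_self (p x : L) : bracket p (bracket x x) = 0 := by
  rw [leibniz, sub_self]

/-- The symmetrised multiplication `y ↦ [x, y] + [y, x]`, which vanishes in a Lie algebra. -/
def symBracket (x : L) : L →ₗ[ℂ] L := bracket x + bracket.flip x

theorem symBracket_apply (x y : L) : symBracket x y = bracket x y + bracket y x := rfl

theorem bracket_symBracket (p x y : L) : bracket p (symBracket x y) = 0 := by
  rw [symBracket_apply, map_add, leibniz p x y, leibniz p y x]
  abel

theorem symBracket_bracket (x y z : L) : symBracket x (bracket y z) =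
    bracket (symBracket x y) z - bracket (symBracket x z) y + symBracket y (bracket z x) := by
  simp only [symBracket_apply, map_add, LinearMap.add_apply, leibniz x y z,
    bracket_bracket_right y z x]
  abel

theorem symBracket_bracket_self (x y : L) : symBracket x (bracket y x) =
    bracket (symBracket x y) x - bracket (bracket x x) y := by
  simp only [symBracket_apply, map_add, LinearMap.add_apply, leibniz x y x]
  abel

variable {N : Submodule ℂ L} (hI : IsIdeal N)
include hI

theorem IsIdeal.symBracket_mem (x : L) {y : L} (hy : y ∈ N) : symBracket x y ∈ N :=
  add_mem (hI y hy x).2 (hI y hy x).1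

variable (hN : IsCoatom N)
include hN

theorem IsIdeal.bracket_self_mem_of_isCoatom (x : L) : bracket x x ∈ N := by
  by_cases hx : x ∈ N
  · exact (hI x hx x).1
  obtain ⟨c, y, hy, h⟩ := exists_eq_smul_add_of_isCoatom hN hx (bracket x x)
  -- `[x, [x, x]] = 0` reads `c² x ≡ 0` modulo `N`.
  have hcc : c • c • x ∈ N := by
    have h0 := bracket_bracket_self x x
    rw [h, map_add, map_smul, h, smul_add, add_assoc] at h0
    rw [eq_neg_of_add_eq_zero_left h0]
    exact neg_mem (add_mem (N.smul_mem _ hy) (hI y hy x).2)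
  obtain rfl : c = 0 := by
    by_contra hc
    exact hx ((N.smul_mem_iff hc).1 ((N.smul_mem_iff hc).1 hcc))
  rwa [h, zero_smul, zero_add]

theorem IsIdeal.bracket_mem_of_isCoatom (r s : L) : bracket r s ∈ N := by
  obtain ⟨x, -, hx⟩ := SetLike.exists_of_lt hN.lt_top
  obtain ⟨c, y, hy, rfl⟩ := exists_eq_smul_add_of_isCoatom hN hx r
  obtain ⟨d, w, hw, rfl⟩ := exists_eq_smul_add_of_isCoatom hN hx s
  simp only [map_add, map_smul, LinearMap.add_apply, LinearMap.smul_apply]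
  exact add_mem
    (N.smul_mem _ (add_mem (N.smul_mem _ (hI.bracket_self_mem_of_isCoatom hN x)) (hI y hy x).1))
    (add_mem (N.smul_mem _ (hI w hw x).2) (hI w hw y).2)

end Leibniz

theorem IsNilradical.not_nilpotent_top {L : Type*} [AddCommGroup L] [Module ℂ L]
    [LeibnizAlgebra L] {N : Submodule ℂ L} (h : IsNilradical N) (hN : N ≠ ⊤) :
    ¬Nilpotent (⊤ : Submodule ℂ L) := fun hnil =>
  hN <| top_le_iff.1 <|
    h.le_of_ge ⟨fun _ _ _ => ⟨Submodule.mem_top, Submodule.mem_top⟩, hnil⟩ le_top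

theorem eq_one_or_eq_last_or_eq_add_two {l i : ℕ} (hi : i ∈ Finset.Icc 1 (l + 3)) :
    i = 1 ∨ i = l + 3 ∨ ∃ k ≤ l, i = k + 2 := by
  rw [Finset.mem_Icc] at hi
  rcases eq_or_ne i 1 with h₁ | h₁
  · exact .inl h₁
  rcases eq_or_ne i (l + 3) with hₙ | hₙ
  · exact .inr (.inl hₙ)
  exact .inr (.inr ⟨i - 2, by omega, by omega⟩)

section Frame

variable {R : Type*} [AddCommGroup R] [Module ℂ R] [LeibnizAlgebra R]

/-- A spanning family of `N` which multiplies like the basis of `g²_{(n,1)}` for `n = l + 3`: here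
`f k` stands for `e_{k+2}`, continued by `0` beyond `f l = e_{n-1}`, so that the products hold for
all `k` without case distinctions. Linear independence follows from `f l ≠ 0`. -/
structure G2Frame (l : ℕ) (N : Submodule ℂ R) where
  e₁ : R
  eₙ : R
  f : ℕ → R
  e₁_mem : e₁ ∈ N
  eₙ_mem : eₙ ∈ N
  f_mem : ∀ k, f k ∈ N
  le_span : N ≤ Submodule.span ℂ {e₁, eₙ} ⊔ spanTail ℂ f 0
  f_last_ne_zero : f l ≠ 0
  f_eq_zero : ∀ k, l < k → f k = 0
  bracket_e₁_e₁ : bracket e₁ e₁ = 0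
  bracket_e₁_eₙ : bracket e₁ eₙ = 0
  bracket_eₙ_e₁ : bracket eₙ e₁ = 0
  bracket_eₙ_eₙ : bracket eₙ eₙ = 0
  bracket_e₁_f : ∀ k, bracket e₁ (f k) = f (k + 1)
  bracket_f_e₁ : ∀ k, bracket (f k) e₁ = -f (k + 1)
  bracket_f_eₙ : ∀ k, bracket (f k) eₙ = f (k + 2)
  bracket_eₙ_f : ∀ k, bracket eₙ (f k) = -f (k + 2)
  bracket_f_f : ∀ j k, bracket (f j) (f k) = 0

namespace G2Frame

attribute [simp] bracket_e₁_e₁ bracket_e₁_eₙ bracket_eₙ_e₁ bracket_eₙ_eₙ bracket_e₁_f bracket_f_e₁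
  bracket_f_eₙ bracket_eₙ_f bracket_f_f

variable {l : ℕ} {N : Submodule ℂ R} (F : G2Frame l N)

/-- The span of `f k, f (k + 1), …`, that is, of `e_{k+2}, …, e_{n-1}`. -/
abbrev tail (k : ℕ) : Submodule ℂ R := spanTail ℂ F.f k

theorem tail_eq_bot {k : ℕ} (hk : l < k) : F.tail k = ⊥ :=
  spanTail.eq_bot fun j hj => F.f_eq_zero j (hk.trans_le hj)

variable {F} in
theorem eq_zero_of_mem_tail {k : ℕ} (hk : l < k) {y : R} (hy : y ∈ F.tail k) : y = 0 :=
  (Submodule.mem_bot ℂ).1 (F.tail_eq_bot hk ▸ hy)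

theorem tail_le (k : ℕ) : F.tail k ≤ N := spanTail.le_iff.2 fun j _ => F.f_mem j

theorem f_mem_tail_zero (k : ℕ) : F.f k ∈ F.tail 0 := spanTail.apply_mem k.zero_le

theorem tail_le_tail_zero (k : ℕ) : F.tail k ≤ F.tail 0 := spanTail.antitone F.f k.zero_le

theorem exists_coord {y : R} (hy : y ∈ N) :
    ∃ p q : ℂ, ∃ v ∈ F.tail 0, y = p • F.e₁ + q • F.eₙ + v := by
  obtain ⟨_, hpq, v, hv, rfl⟩ := Submodule.mem_sup.1 (F.le_span hy)
  obtain ⟨p, q, rfl⟩ := Submodule.mem_span_pair.1 hpq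
  exact ⟨p, q, v, hv, rfl⟩

section Products

variable {F}

theorem bracket_e₁_mem_tail {k : ℕ} {y : R} (hy : y ∈ F.tail k) :
    bracket F.e₁ y ∈ F.tail (k + 1) :=
  spanTail.map_mem (fun j hj => by
    rw [F.bracket_e₁_f]; exact spanTail.apply_mem (Nat.succ_le_succ hj)) hy

theorem bracket_tail_e₁ {y : R} (hy : y ∈ F.tail 0) : bracket y F.e₁ = -bracket F.e₁ y :=
  spanTail.map_eq_map (g := bracket.flip F.e₁) (g' := -bracket F.e₁) (fun j _ => by simp) hy

theorem bracket_tail_eₙ {y : R} (hy : y ∈ F.tail 0) :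
    bracket y F.eₙ = bracket F.e₁ (bracket F.e₁ y) :=
  spanTail.map_eq_map (g := bracket.flip F.eₙ) (g' := bracket F.e₁ ∘ₗ bracket F.e₁)
    (fun j _ => by simp) hy

theorem bracket_eₙ_tail {y : R} (hy : y ∈ F.tail 0) :
    bracket F.eₙ y = -bracket F.e₁ (bracket F.e₁ y) :=
  spanTail.map_eq_map (g' := -(bracket F.e₁ ∘ₗ bracket F.e₁)) (fun j _ => by simp) hy

theorem bracket_tail_tail {y z : R} (hy : y ∈ F.tail 0) (hz : z ∈ F.tail 0) :
    bracket y z = 0 := by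
  refine spanTail.map_eq_map (g' := 0) (fun k _ => ?_) hz
  exact spanTail.map_eq_map (g := bracket.flip (F.f k)) (g' := 0) (fun j _ => by simp) hy

theorem bracket_mem_tail_zero {y z : R} (hy : y ∈ N) (hz : z ∈ N) : bracket y z ∈ F.tail 0 := by
  obtain ⟨p, q, v, hv, rfl⟩ := F.exists_coord hy
  obtain ⟨p', q', w, hw, rfl⟩ := F.exists_coord hz
  have hT {u : R} (hu : u ∈ F.tail 0) : bracket F.e₁ u ∈ F.tail 0 :=
    F.tail_le_tail_zero 1 (bracket_e₁_mem_tail hu)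
  simp only [map_add, map_smul, LinearMap.add_apply, LinearMap.smul_apply, bracket_e₁_e₁,
    bracket_e₁_eₙ, bracket_eₙ_e₁, bracket_eₙ_eₙ, bracket_tail_e₁ hv, bracket_tail_eₙ hv,
    bracket_eₙ_tail hw, bracket_tail_tail hv hw, smul_zero, zero_add, add_zero]
  exact add_mem (add_mem (Submodule.smul_mem _ _ (neg_mem (hT hv)))
    (Submodule.smul_mem _ _ (hT (hT hv)))) (add_mem (Submodule.smul_mem _ _ (hT hw))
      (Submodule.smul_mem _ _ (neg_mem (hT (hT hw)))))

variable (F)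

theorem bracket_e₁_pow_f (j k : ℕ) : (bracket F.e₁ ^ j) (F.f k) = F.f (k + j) := by
  induction j with
  | zero => simp
  | succ j ih => rw [pow_succ', Module.End.mul_apply, ih, F.bracket_e₁_f, add_assoc]

variable {F}

theorem bracket_e₁_pow_mem_tail (j : ℕ) {k : ℕ} {y : R} (hy : y ∈ F.tail k) :
    (bracket F.e₁ ^ j) y ∈ F.tail (k + j) :=
  spanTail.map_mem (fun i hi => by
    rw [F.bracket_e₁_pow_f]; exact spanTail.apply_mem (Nat.add_le_add_right hi j)) hy

end Products

section Independence

theorem f_notMem_tail_succ {k : ℕ} (hk : k ≤ l) : F.f k ∉ F.tail (k + 1) := fun h => by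
  have hl := eq_zero_of_mem_tail (by omega) (bracket_e₁_pow_mem_tail (l - k) h)
  rw [F.bracket_e₁_pow_f, Nat.add_sub_cancel' hk] at hl
  exact F.f_last_ne_zero hl

variable {F}

theorem eq_zero_of_smul_f_add {k : ℕ} (hk : k ≤ l) {c : ℂ} {y : R} (hy : y ∈ F.tail (k + 1))
    (h : c • F.f k + y = 0) : c = 0 := by
  by_contra hc
  refine F.f_notMem_tail_succ hk ((Submodule.smul_mem_iff _ hc).1 ?_)
  rw [eq_neg_of_add_eq_zero_left h]
  exact neg_mem hy

theorem eq_zero_of_smul_f {k : ℕ} (hk : k ≤ l) {c : ℂ} (h : c • F.f k = 0) : c = 0 :=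
  eq_zero_of_smul_f_add hk (zero_mem _) ((add_zero _).trans h)

theorem mem_tail_succ_of_bracket_e₁_mem {k : ℕ} (hk : k < l) {y : R} (hy : y ∈ F.tail k)
    (h : bracket F.e₁ y ∈ F.tail (k + 2)) : y ∈ F.tail (k + 1) := by
  obtain ⟨c, z, hz, rfl⟩ := spanTail.exists_smul_add hy
  rw [map_add, map_smul, F.bracket_e₁_f] at h
  obtain rfl : c = 0 := by
    by_contra hc
    have hcf := (Submodule.add_mem_iff_left _ (bracket_e₁_mem_tail hz)).1 h
    exact F.f_notMem_tail_succ hk ((Submodule.smul_mem_iff _ hc).1 hcf)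
  rwa [zero_smul, zero_add]

theorem exists_eq_smul_f_last_of_bracket_e₁_eq_zero {y : R} (hy : y ∈ F.tail 0)
    (h : bracket F.e₁ y = 0) : ∃ c : ℂ, y = c • F.f l := by
  have hmem : ∀ k ≤ l, y ∈ F.tail k := by
    intro k
    induction k with
    | zero => exact fun _ => hy
    | succ k ih =>
      exact fun hk => mem_tail_succ_of_bracket_e₁_mem hk (ih (by omega)) (h ▸ zero_mem _)
  obtain ⟨c, z, hz, rfl⟩ := spanTail.exists_smul_add (hmem l le_rfl)
  exact ⟨c, by rw [eq_zero_of_mem_tail (Nat.lt_add_one l) hz, add_zero]⟩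

theorem mem_tail_zero_of_bracket_f_eq_zero {k : ℕ} (hk : k + 2 ≤ l) {y : R} (hy : y ∈ N)
    (h : bracket (F.f k) y = 0) : y ∈ F.tail 0 := by
  obtain ⟨p, q, v, hv, rfl⟩ := F.exists_coord hy
  simp only [map_add, map_smul, bracket_f_e₁, bracket_f_eₙ,
    bracket_tail_tail (F.f_mem_tail_zero k) hv, add_zero, smul_neg, ← neg_smul] at h
  have hp : -p = 0 := eq_zero_of_smul_f_add (by omega)
    (Submodule.smul_mem _ _ (spanTail.apply_mem le_rfl)) h
  rw [hp, zero_smul, zero_add] at h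
  rw [neg_eq_zero.1 hp, eq_zero_of_smul_f hk h]
  simpa only [zero_smul, zero_add] using hv

theorem exists_eq_smul_f_last_of_forall_bracket_eq_zero (hl : 2 ≤ l) {r : R} (hr : r ∈ N)
    (h : ∀ p, bracket p r = 0) : ∃ c : ℂ, r = c • F.f l :=
  exists_eq_smul_f_last_of_bracket_e₁_eq_zero
    (mem_tail_zero_of_bracket_f_eq_zero (k := 0) hl hr (h _)) (h _)

variable (F)

theorem bracket_f_last {y : R} (hy : y ∈ N) : bracket (F.f l) y = 0 := by
  obtain ⟨p, q, v, hv, rfl⟩ := F.exists_coord hy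
  simp [bracket_tail_tail (F.f_mem_tail_zero l) hv, F.f_eq_zero]

end Independence

section RightMul

/-- Right multiplication by `x` is the derivation of `N` determined by the scalars `a`, `b`, `γ`
and the vectors `v`, `z`: it sends `e₁` to `a e₁ + v`, `f 0` to `b f₀ + z`, and `eₙ` to
`2a eₙ - [e₁, v] + γ f_l`. -/
structure RightMulForm (x : R) (a b γ : ℂ) (v z : R) : Prop where
  v_mem : v ∈ F.tail 0
  z_mem : z ∈ F.tail 1
  e₁_x : bracket F.e₁ x = a • F.e₁ + v
  eₙ_x : bracket F.eₙ x = (2 * a) • F.eₙ - bracket F.e₁ v + γ • F.f l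
  f_zero_x : bracket (F.f 0) x = b • F.f 0 + z

section Existence

variable {F} {x : R}

theorem bracket_f_zero_x_mem_tail (hl : 3 ≤ l) (hx : ∀ y ∈ N, bracket y x ∈ N) :
    bracket (F.f 0) x ∈ F.tail 0 := by
  have hf₁ : bracket (F.f 1) x ∈ F.tail 0 := by
    rw [← F.bracket_e₁_f 0, bracket_bracket_right]
    exact add_mem (bracket_mem_tail_zero (hx _ F.e₁_mem) (F.f_mem 0))
      (bracket_mem_tail_zero F.e₁_mem (hx _ (F.f_mem 0)))
  refine mem_tail_zero_of_bracket_f_eq_zero (k := 1) hl (hx _ (F.f_mem 0)) ?_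
  have h := bracket_bracket_right (F.f 1) (F.f 0) x
  rwa [bracket_f_f, map_zero, LinearMap.zero_apply,
    bracket_tail_tail hf₁ (F.f_mem_tail_zero 0), zero_add, eq_comm] at h

theorem bracket_bracket_e₁_x {a c : ℂ} {v : R} (hv : v ∈ F.tail 0)
    (h₁ : bracket F.e₁ x = a • F.e₁ + c • F.eₙ + v) {y : R} (hy : y ∈ F.tail 0) :
    bracket (bracket F.e₁ y) x = a • bracket F.e₁ y - c • bracket F.e₁ (bracket F.e₁ y) +
      bracket F.e₁ (bracket y x) := by
  simp only [bracket_bracket_right F.e₁ y x, h₁, map_add, map_smul, LinearMap.add_apply,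
    LinearMap.smul_apply, bracket_eₙ_tail hy, bracket_tail_tail hv hy]
  module

theorem coeff_eq_of_bracket_x_eq (hl : 3 ≤ l) {a c α β : ℂ} {v w : R} (hv : v ∈ F.tail 0)
    (hw : w ∈ F.tail 0) (h₀ : bracket (F.f 0) x ∈ F.tail 0)
    (h₁ : bracket F.e₁ x = a • F.e₁ + c • F.eₙ + v)
    (hₙ : bracket F.eₙ x = α • F.e₁ + β • F.eₙ + w) : c = 0 ∧ α = 0 ∧ β = 2 * a := by
  -- Compute `[f 2, x]` twice, since `f 2` is both `[e₁, [e₁, f 0]]` and `[f 0, eₙ]`.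
  have hf₁ := bracket_bracket_e₁_x hv h₁ (F.f_mem_tail_zero 0)
  have hf₂ := bracket_bracket_e₁_x hv h₁ (F.f_mem_tail_zero 1)
  have hf₂' := bracket_bracket_right (F.f 0) F.eₙ x
  simp only [bracket_e₁_f, zero_add, Nat.reduceAdd] at hf₁ hf₂
  simp only [hf₁, map_add, map_sub, map_smul, bracket_e₁_f, Nat.reduceAdd] at hf₂
  simp only [hₙ, map_add, map_smul, bracket_f_e₁, bracket_f_eₙ, bracket_tail_eₙ h₀,
    bracket_tail_tail (F.f_mem_tail_zero 0) hw, zero_add] at hf₂'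
  have hcomb : α • F.f 1 + ((2 * a - β) • F.f 2 + (-2 * c) • F.f 3) = 0 := by
    rw [← sub_eq_zero.2 (hf₂.symm.trans hf₂')]
    module
  have hα : α = 0 := eq_zero_of_smul_f_add (by omega)
    (add_mem (Submodule.smul_mem _ _ (spanTail.apply_mem (by omega)))
      (Submodule.smul_mem _ _ (spanTail.apply_mem (by omega)))) hcomb
  rw [hα, zero_smul, zero_add] at hcomb
  have hβ : 2 * a - β = 0 := eq_zero_of_smul_f_add (by omega)
    (Submodule.smul_mem _ _ (spanTail.apply_mem le_rfl)) hcomb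
  rw [hβ, zero_smul, zero_add] at hcomb
  have hc : -2 * c = 0 := eq_zero_of_smul_f hl hcomb
  exact ⟨by simpa using hc, hα, (sub_eq_zero.1 hβ).symm⟩

theorem exists_rightMulForm (F : G2Frame l N) (hl : 3 ≤ l) (hx : ∀ y ∈ N, bracket y x ∈ N) :
    ∃ a b γ v z, F.RightMulForm x a b γ v z := by
  obtain ⟨a, c, v, hv, h₁⟩ := F.exists_coord (hx _ F.e₁_mem)
  obtain ⟨α, β, w, hw, hₙ⟩ := F.exists_coord (hx _ F.eₙ_mem)
  have h₀ := bracket_f_zero_x_mem_tail (F := F) hl hx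
  obtain ⟨rfl, rfl, rfl⟩ := coeff_eq_of_bracket_x_eq hl hv hw h₀ h₁ hₙ
  obtain ⟨b, z, hz, h₀⟩ := spanTail.exists_smul_add h₀
  have hker : bracket F.e₁ (bracket F.e₁ v + w) = 0 := by
    have h := bracket_bracket_right F.e₁ F.eₙ x
    simpa [h₁, hₙ, bracket_tail_eₙ hv, eq_comm] using h
  obtain ⟨γ, hγ⟩ := exists_eq_smul_f_last_of_bracket_e₁_eq_zero
    (add_mem (F.tail_le_tail_zero 1 (bracket_e₁_mem_tail hv)) hw) hker
  refine ⟨a, b, γ, v, z, hv, hz, ?_, ?_, h₀⟩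
  · rw [h₁, zero_smul, add_zero]
  · rw [hₙ, ← hγ]
    module

end Existence

namespace RightMulForm

variable {F} {x : R} {a b γ : ℂ} {v z : R} (A : F.RightMulForm x a b γ v z)
include A

theorem bracket_bracket_e₁_x {y : R} (hy : y ∈ F.tail 0) :
    bracket (bracket F.e₁ y) x = a • bracket F.e₁ y + bracket F.e₁ (bracket y x) := by
  rw [bracket_bracket_right, A.e₁_x]
  simp [bracket_tail_tail A.v_mem hy]

theorem f_x (k : ℕ) : bracket (F.f k) x = (b + k * a) • F.f k + (bracket F.e₁ ^ k) z := by
  induction k with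
  | zero => simp [A.f_zero_x]
  | succ k ih =>
    rw [← F.bracket_e₁_f, A.bracket_bracket_e₁_x (F.f_mem_tail_zero k), ih, map_add, map_smul,
      bracket_e₁_f, pow_succ', Module.End.mul_apply]
    push_cast
    module

theorem f_x_sub_mem (k : ℕ) : bracket (F.f k) x - (b + k * a) • F.f k ∈ F.tail (k + 1) := by
  rw [A.f_x, add_sub_cancel_left, add_comm k]
  exact bracket_e₁_pow_mem_tail k A.z_mem

theorem bracket_tail_x_mem {k : ℕ} {y : R} (hy : y ∈ F.tail k) : bracket y x ∈ F.tail k :=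
  spanTail.map_mem (g := bracket.flip x) (fun j hj => by
    rw [LinearMap.flip_apply, ← sub_add_cancel (bracket (F.f j) x) ((b + j * a) • F.f j)]
    exact add_mem (spanTail.antitone F.f (by omega) (A.f_x_sub_mem j))
      (Submodule.smul_mem _ _ (spanTail.apply_mem hj))) hy

theorem f_last_x : bracket (F.f l) x = (b + l * a) • F.f l :=
  sub_eq_zero.1 (eq_zero_of_mem_tail (Nat.lt_add_one l) (A.f_x_sub_mem l))

end RightMulForm

end RightMul

section LeftMul

theorem exists_symBracket_eq_smul_f_last (hl : 2 ≤ l) (hI : IsIdeal N) (x : R) {y : R}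
    (hy : y ∈ N) : ∃ c : ℂ, symBracket x y = c • F.f l :=
  exists_eq_smul_f_last_of_forall_bracket_eq_zero hl (hI.symBracket_mem x hy)
    fun p => bracket_symBracket p x y

namespace RightMulForm

variable {F} {x : R} {a b γ : ℂ} {v z : R} (A : F.RightMulForm x a b γ v z) (hl : 2 ≤ l)
  (hI : IsIdeal N)
include A hl hI

theorem symBracket_bracket_e₁_eq_zero {y : R} (hy : y ∈ F.tail 0) :
    symBracket x (bracket F.e₁ y) = 0 := by
  obtain ⟨c, hc⟩ := F.exists_symBracket_eq_smul_f_last hl hI x F.e₁_mem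
  obtain ⟨d, hd⟩ := F.exists_symBracket_eq_smul_f_last hl hI x (F.tail_le 0 hy)
  rw [symBracket_bracket, hc, hd, symBracket_apply, bracket_tail_e₁ (A.bracket_tail_x_mem hy)]
  simp [F.bracket_f_last (F.tail_le 0 hy), F.f_eq_zero]

theorem symBracket_eq_zero_of_mem_tail_one {y : R} (hy : y ∈ F.tail 1) : symBracket x y = 0 :=
  spanTail.map_eq_map (g' := 0) (fun j hj => by
    obtain ⟨k, rfl⟩ := Nat.exists_eq_add_of_le' hj
    rw [← F.bracket_e₁_f]
    exact A.symBracket_bracket_e₁_eq_zero hl hI (F.f_mem_tail_zero k)) hy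

theorem bracket_x_f_last : bracket x (F.f l) = -((b + l * a) • F.f l) := by
  rw [← A.f_last_x, eq_neg_iff_add_eq_zero]
  exact A.symBracket_eq_zero_of_mem_tail_one hl hI (spanTail.apply_mem (by omega))

theorem exists_eq_smul_f_last_and_mul_eq_zero {r : R} (hr : r ∈ N) (h : ∀ p, bracket p r = 0) :
    ∃ c : ℂ, r = c • F.f l ∧ c * (b + l * a) = 0 := by
  obtain ⟨c, rfl⟩ := exists_eq_smul_f_last_of_forall_bracket_eq_zero (F := F) hl hr h
  refine ⟨c, rfl, ?_⟩
  have hx := h x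
  rw [map_smul, A.bracket_x_f_last hl hI, smul_neg, smul_smul, ← neg_smul] at hx
  exact neg_eq_zero.1 (eq_zero_of_smul_f le_rfl hx)

variable (hN : IsCoatom N)
include hN

theorem exists_bracket_self_eq :
    ∃ c : ℂ, bracket x x = c • F.f l ∧ c * (b + l * a) = 0 :=
  A.exists_eq_smul_f_last_and_mul_eq_zero hl hI (hI.bracket_self_mem_of_isCoatom hN x)
    fun p => bracket_bracket_self p x

theorem bracket_self_eq_zero (h : b + l * a ≠ 0) : bracket x x = 0 := by
  obtain ⟨c, hc, hc0⟩ := A.exists_bracket_self_eq hl hI hN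
  rw [hc, (mul_eq_zero.1 hc0).resolve_right h, zero_smul]

theorem symBracket_bracket_x_eq_zero {y : R} (hy : y ∈ N) : symBracket x (bracket y x) = 0 := by
  obtain ⟨c, hc, hc0⟩ := A.exists_eq_smul_f_last_and_mul_eq_zero hl hI (hI.symBracket_mem x hy)
    fun p => bracket_symBracket p x y
  obtain ⟨d, hd, -⟩ := A.exists_bracket_self_eq hl hI hN
  rw [symBracket_bracket_self, hc, hd]
  simp [F.bracket_f_last hy, A.f_last_x, smul_smul, hc0]

theorem symBracket_eq_zero_of_ne_zero (ha : a ≠ 0) (hb : b ≠ 0) {y : R} (hy : y ∈ N) :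
    symBracket x y = 0 := by
  have hS {y : R} (hy : y ∈ N) := A.symBracket_bracket_x_eq_zero hl hI hN hy
  have hS₁ {y : R} (hy : y ∈ F.tail 1) := A.symBracket_eq_zero_of_mem_tail_one hl hI hy
  have hf₀ : symBracket x (F.f 0) = 0 := by
    simpa [A.f_zero_x, hS₁ A.z_mem, hb] using hS (F.f_mem 0)
  have hS₀ {y : R} (hy : y ∈ F.tail 0) : symBracket x y = 0 := by
    obtain ⟨c, y', hy', rfl⟩ := spanTail.exists_smul_add hy
    rw [map_add, map_smul, hf₀, hS₁ hy', smul_zero, add_zero]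
  have he₁ : symBracket x F.e₁ = 0 := by
    simpa [A.e₁_x, hS₀ A.v_mem, ha] using hS F.e₁_mem
  have heₙ : symBracket x F.eₙ = 0 := by
    simpa [A.eₙ_x, hS₁ (bracket_e₁_mem_tail A.v_mem), hS₀ (F.f_mem_tail_zero l), ha]
      using hS F.eₙ_mem
  obtain ⟨p, q, w, hw, rfl⟩ := F.exists_coord hy
  simp [he₁, heₙ, hS₀ hw]

theorem bracket_x_eq_neg (hab : ¬(a = 0 ∧ b = 0)) {y : R} (hy : y ∈ N) :
    bracket x y = -bracket y x := by
  rw [eq_neg_iff_add_eq_zero, ← symBracket_apply]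
  by_cases hba : b + l * a = 0
  · have hl₀ : (l : ℂ) ≠ 0 := by
      rw [Nat.cast_ne_zero]
      omega
    refine A.symBracket_eq_zero_of_ne_zero hl hI hN (fun ha => hab ⟨ha, ?_⟩)
      (fun hb => hab ⟨?_, hb⟩) hy
    · simpa [ha] using hba
    · simpa [hb, hl₀] using hba
  · obtain ⟨c, hc, hc0⟩ := A.exists_eq_smul_f_last_and_mul_eq_zero hl hI (hI.symBracket_mem x hy)
      fun p => bracket_symBracket p x y
    rw [hc, (mul_eq_zero.1 hc0).resolve_right hba, zero_smul]

end RightMulForm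

end LeftMul

section NotNilpotent

namespace RightMulForm

variable {F} {x : R} {γ : ℂ} {v z : R} (A : F.RightMulForm x 0 0 γ v z)
include A

theorem bracket_x_mem_tail_zero {y : R} (hy : y ∈ N) : bracket y x ∈ F.tail 0 := by
  obtain ⟨p, q, w, hw, rfl⟩ := F.exists_coord hy
  simp only [map_add, map_smul, LinearMap.add_apply, LinearMap.smul_apply, A.e₁_x, A.eₙ_x,
    mul_zero, zero_smul, zero_add, zero_sub]
  exact add_mem (add_mem (Submodule.smul_mem _ _ A.v_mem) (Submodule.smul_mem _ _
    (add_mem (neg_mem (F.tail_le_tail_zero 1 (bracket_e₁_mem_tail A.v_mem)))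
      (Submodule.smul_mem _ _ (F.f_mem_tail_zero l))))) (A.bracket_tail_x_mem hw)

theorem bracket_x_mem_tail_succ {k : ℕ} {y : R} (hy : y ∈ F.tail k) :
    bracket y x ∈ F.tail (k + 1) :=
  spanTail.map_mem (g := bracket.flip x) (fun j hj => by
    have h := A.f_x_sub_mem j
    rw [mul_zero, add_zero, zero_smul, sub_zero] at h
    exact spanTail.antitone F.f (Nat.succ_le_succ hj) h) hy

variable (hN : IsCoatom N) (hx : x ∉ N)
include hN hx

theorem bracket_mem_tail_succ {k : ℕ} {y : R} (hy : y ∈ F.tail k) (r : R) :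
    bracket y r ∈ F.tail (k + 1) := by
  obtain ⟨c, u, hu, rfl⟩ := exists_eq_smul_add_of_isCoatom hN hx r
  obtain ⟨p, q, w, hw, rfl⟩ := F.exists_coord hu
  have hy₀ := F.tail_le_tail_zero k hy
  have hTy := bracket_e₁_mem_tail hy
  simp only [map_add, map_smul, bracket_tail_e₁ hy₀, bracket_tail_eₙ hy₀,
    bracket_tail_tail hy₀ hw, add_zero]
  exact add_mem (Submodule.smul_mem _ _ (A.bracket_x_mem_tail_succ hy))
    (add_mem (Submodule.smul_mem _ _ (neg_mem hTy)) (Submodule.smul_mem _ _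
      (spanTail.antitone F.f (Nat.le_succ _) (bracket_e₁_mem_tail hTy))))

theorem lowerCentral_top_le_tail (hI : IsIdeal N) (k : ℕ) :
    lowerCentral (⊤ : Submodule ℂ R) (k + 2) ≤ F.tail k := by
  induction k with
  | zero =>
    refine Submodule.map₂_le.2 fun y hy r _ => ?_
    have hyN : y ∈ N :=
      (Submodule.map₂_le.2 fun r _ s _ => hI.bracket_mem_of_isCoatom hN r s : _ ≤ N) hy
    obtain ⟨c, u, hu, rfl⟩ := exists_eq_smul_add_of_isCoatom hN hx r
    rw [map_add, map_smul]
    exact add_mem (Submodule.smul_mem _ _ (A.bracket_x_mem_tail_zero hyN))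
      (bracket_mem_tail_zero hyN hu)
  | succ k ih =>
    exact Submodule.map₂_le.2 fun y hy r _ => A.bracket_mem_tail_succ hN hx (ih hy) r

theorem nilpotent_top (hI : IsIdeal N) : Nilpotent (⊤ : Submodule ℂ R) :=
  ⟨l + 1 + 2, eq_bot_iff.2 <|
    (A.lowerCentral_top_le_tail hN hx hI (l + 1)).trans_eq (F.tail_eq_bot (Nat.lt_add_one l))⟩

end RightMulForm

end NotNilpotent

section ChangeOfFrame

/-- The change of basis `e₁ ↦ e₁ + u`, `eₙ ↦ eₙ - [e₁, u] + s f_l`, which keeps the `f k`. The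
summand `-[e₁, u]` restores `[e₁, eₙ] = 0`. -/
@[simps]
def shiftE₁ {u : R} (hu : u ∈ F.tail 0) (s : ℂ) : G2Frame l N :=
  have hTu : bracket F.e₁ u ∈ F.tail 0 := F.tail_le_tail_zero 1 (bracket_e₁_mem_tail hu)
  have hf := F.f_mem_tail_zero
  { e₁ := F.e₁ + u
    eₙ := F.eₙ - bracket F.e₁ u + s • F.f l
    f := F.f
    e₁_mem := add_mem F.e₁_mem (F.tail_le 0 hu)
    eₙ_mem := add_mem (sub_mem F.eₙ_mem (F.tail_le 0 hTu)) (N.smul_mem s (F.f_mem l))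
    f_mem := F.f_mem
    le_span := fun y hy => by
      obtain ⟨p, q, v, hv, rfl⟩ := F.exists_coord hy
      refine Submodule.mem_sup.2 ⟨_, Submodule.mem_span_pair.2 ⟨p, q, rfl⟩,
        v - p • u + q • bracket F.e₁ u - (q * s) • F.f l, ?_, by module⟩
      exact sub_mem (add_mem (sub_mem hv (Submodule.smul_mem _ _ hu)) (Submodule.smul_mem _ _ hTu))
        (Submodule.smul_mem _ _ (hf l))
    f_last_ne_zero := F.f_last_ne_zero
    f_eq_zero := F.f_eq_zero
    bracket_e₁_e₁ := by simp [bracket_tail_e₁ hu, bracket_tail_tail hu hu]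
    bracket_e₁_eₙ := by
      simp [bracket_tail_eₙ hu, bracket_tail_tail hu hTu, bracket_tail_tail hu (hf l), F.f_eq_zero]
    bracket_eₙ_e₁ := by
      simp [bracket_eₙ_tail hu, bracket_tail_e₁ hTu, bracket_tail_tail hTu hu,
        bracket_tail_tail (hf l) hu, F.f_eq_zero]
    bracket_eₙ_eₙ := by
      simp [bracket_eₙ_tail hTu, bracket_tail_eₙ hTu, bracket_tail_tail hTu hTu,
        bracket_tail_tail hTu (hf l), bracket_tail_tail (hf l) hTu, F.f_eq_zero]
    bracket_e₁_f := fun k => by simp [bracket_tail_tail hu (hf k)]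
    bracket_f_e₁ := fun k => by simp [bracket_tail_tail (hf k) hu]
    bracket_f_eₙ := fun k => by simp [bracket_tail_tail (hf k) hTu]
    bracket_eₙ_f := fun k => by simp [bracket_tail_tail hTu (hf k)]
    bracket_f_f := F.bracket_f_f }

variable {F} in
theorem f_add_pow_sub_f_mem {w : R} (hw : w ∈ F.tail 1) (k : ℕ) :
    F.f k + (bracket F.e₁ ^ k) w - F.f k ∈ F.tail (k + 1) := by
  rw [add_sub_cancel_left, add_comm k]
  exact bracket_e₁_pow_mem_tail k hw

theorem spanTail_f_add_pow {w : R} (hw : w ∈ F.tail 1) (k : ℕ) :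
    spanTail ℂ (fun k => F.f k + (bracket F.e₁ ^ k) w) k = F.tail k :=
  spanTail.eq_of_sub_mem F.f_eq_zero (f_add_pow_sub_f_mem hw) k

variable {F} in
theorem f_add_pow_mem_tail {w : R} (hw : w ∈ F.tail 1) (k : ℕ) :
    F.f k + (bracket F.e₁ ^ k) w ∈ F.tail k :=
  F.spanTail_f_add_pow hw k ▸ spanTail.apply_mem (f := fun k => F.f k + (bracket F.e₁ ^ k) w) le_rfl

/-- The change of basis `f 0 ↦ f 0 + w`, which keeps `e₁` and `eₙ` and hence sends `f k` to
`f k + (ad e₁)^k w`. -/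
@[simps]
def shiftF {w : R} (hw : w ∈ F.tail 1) : G2Frame l N :=
  have hf (k : ℕ) : F.f k + (bracket F.e₁ ^ k) w ∈ F.tail 0 :=
    F.tail_le_tail_zero k (f_add_pow_mem_tail hw k)
  have he₁ (k : ℕ) : bracket F.e₁ (F.f k + (bracket F.e₁ ^ k) w) =
      F.f (k + 1) + (bracket F.e₁ ^ (k + 1)) w := by
    rw [map_add, F.bracket_e₁_f, pow_succ', Module.End.mul_apply]
  { e₁ := F.e₁
    eₙ := F.eₙ
    f := fun k => F.f k + (bracket F.e₁ ^ k) w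
    e₁_mem := F.e₁_mem
    eₙ_mem := F.eₙ_mem
    f_mem := fun k => F.tail_le 0 (hf k)
    le_span := (F.spanTail_f_add_pow hw 0).symm ▸ F.le_span
    f_last_ne_zero := by
      rw [sub_eq_zero.1 (eq_zero_of_mem_tail (Nat.lt_add_one l) (f_add_pow_sub_f_mem hw l))]
      exact F.f_last_ne_zero
    f_eq_zero := fun k hk => eq_zero_of_mem_tail hk (f_add_pow_mem_tail hw k)
    bracket_e₁_e₁ := F.bracket_e₁_e₁
    bracket_e₁_eₙ := F.bracket_e₁_eₙ
    bracket_eₙ_e₁ := F.bracket_eₙ_e₁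
    bracket_eₙ_eₙ := F.bracket_eₙ_eₙ
    bracket_e₁_f := he₁
    bracket_f_e₁ := fun k => by rw [bracket_tail_e₁ (hf k), he₁]
    bracket_f_eₙ := fun k => by rw [bracket_tail_eₙ (hf k), he₁, he₁]
    bracket_eₙ_f := fun k => by rw [bracket_eₙ_tail (hf k), he₁, he₁]
    bracket_f_f := fun j k => bracket_tail_tail (hf j) (hf k) }

theorem shiftF_tail {w : R} (hw : w ∈ F.tail 1) (k : ℕ) : (F.shiftF hw).tail k = F.tail k :=
  F.spanTail_f_add_pow hw k

namespace RightMulForm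

variable {F} {x : R} {a b γ : ℂ} {v z : R} (A : F.RightMulForm x a b γ v z)
include A

theorem smul (s : ℂ) : F.RightMulForm (s • x) (s * a) (s * b) (s * γ) (s • v) (s • z) where
  v_mem := Submodule.smul_mem _ _ A.v_mem
  z_mem := Submodule.smul_mem _ _ A.z_mem
  e₁_x := by rw [map_smul, A.e₁_x]; module
  eₙ_x := by rw [map_smul, A.eₙ_x, map_smul]; module
  f_zero_x := by rw [map_smul, A.f_zero_x]; module

theorem add_tail {y : R} (hy : y ∈ F.tail 0) :
    F.RightMulForm (x + y) a b γ (v + bracket F.e₁ y) z where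
  v_mem := add_mem A.v_mem (F.tail_le_tail_zero 1 (bracket_e₁_mem_tail hy))
  z_mem := A.z_mem
  e₁_x := by rw [map_add, A.e₁_x]; module
  eₙ_x := by rw [map_add, A.eₙ_x, map_add, bracket_eₙ_tail hy]; module
  f_zero_x := by
    rw [map_add, A.f_zero_x, bracket_tail_tail (F.f_mem_tail_zero 0) hy, add_zero]

theorem add_smul_e₁ (c : ℂ) : F.RightMulForm (x + c • F.e₁) a b γ v (z - c • F.f 1) where
  v_mem := A.v_mem
  z_mem := sub_mem A.z_mem (Submodule.smul_mem _ _ (spanTail.apply_mem le_rfl))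
  e₁_x := by rw [map_add, A.e₁_x, map_smul, F.bracket_e₁_e₁]; module
  eₙ_x := by rw [map_add, A.eₙ_x, map_smul, F.bracket_eₙ_e₁]; module
  f_zero_x := by rw [map_add, A.f_zero_x, map_smul, F.bracket_f_e₁]; module

theorem shiftE₁ {u : R} (hu : u ∈ F.tail 0) (s : ℂ) : (F.shiftE₁ hu s).RightMulForm x a b
    (γ + s * (b + l * a - 2 * a)) (v + (bracket u x - a • u)) z where
  v_mem := add_mem A.v_mem (sub_mem (A.bracket_tail_x_mem hu) (Submodule.smul_mem _ _ hu))
  z_mem := A.z_mem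
  e₁_x := by simp only [shiftE₁_e₁, map_add, LinearMap.add_apply, A.e₁_x]; module
  eₙ_x := by
    simp only [shiftE₁_e₁, shiftE₁_eₙ, shiftE₁_f, map_add, map_sub, map_smul, LinearMap.add_apply,
      LinearMap.sub_apply, LinearMap.smul_apply, A.eₙ_x, A.bracket_bracket_e₁_x hu, A.f_last_x,
      bracket_tail_tail hu A.v_mem, bracket_tail_tail hu (A.bracket_tail_x_mem hu),
      bracket_tail_tail hu hu]
    module
  f_zero_x := A.f_zero_x

theorem shiftF {w : R} (hw : w ∈ F.tail 1) :
    (F.shiftF hw).RightMulForm x a b γ v (z + (bracket w x - b • w)) where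
  v_mem := F.shiftF_tail hw 0 ▸ A.v_mem
  z_mem := F.shiftF_tail hw 1 ▸
    add_mem A.z_mem (sub_mem (A.bracket_tail_x_mem hw) (Submodule.smul_mem _ _ hw))
  e₁_x := A.e₁_x
  eₙ_x := by
    have hl : (bracket F.e₁ ^ l) w = 0 :=
      eq_zero_of_mem_tail (by omega) (bracket_e₁_pow_mem_tail l hw)
    simp only [shiftF_e₁, shiftF_eₙ, shiftF_f, A.eₙ_x, hl, add_zero]
  f_zero_x := by
    simp only [shiftF_f, pow_zero, Module.End.one_apply, map_add, LinearMap.add_apply, A.f_zero_x]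
    module

end RightMulForm

end ChangeOfFrame

section NormalForm

variable {F} {x : R}

namespace RightMulForm

variable {a b γ : ℂ} {v z : R}

theorem exists_notMem_z_mem_tail_two (A : F.RightMulForm x a 1 γ v z) (hx : x ∉ N) :
    ∃ x' ∉ N, ∃ z' ∈ F.tail 2, F.RightMulForm x' a 1 γ v z' := by
  obtain ⟨c, z', hz', rfl⟩ := spanTail.exists_smul_add A.z_mem
  refine ⟨x + c • F.e₁, (N.add_mem_iff_left (N.smul_mem c F.e₁_mem)).not.2 hx, z', hz', ?_⟩
  simpa only [add_sub_cancel_left] using A.add_smul_e₁ c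

theorem exists_shiftE₁_v_eq_zero (A : F.RightMulForm x 0 1 γ v z) :
    ∃ u, ∃ hu : u ∈ F.tail 0, (F.shiftE₁ hu (-γ)).RightMulForm x 0 1 0 0 z := by
  -- On the span of the `f k`, right multiplication by `x` is unipotent, hence onto.
  obtain ⟨u, hu, hux⟩ := spanTail.le_map_of_triangular (E := bracket.flip x) (μ := fun _ => 1)
    F.f_eq_zero (fun _ _ => one_ne_zero) (fun j _ => by simpa using A.f_x_sub_mem j)
    (neg_mem A.v_mem)
  rw [LinearMap.flip_apply] at hux
  exact ⟨u, hu, by simpa [hux] using A.shiftE₁ hu (-γ)⟩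

theorem exists_shiftF_z_eq_zero (A : F.RightMulForm x 1 b γ v z) :
    ∃ w, ∃ hw : w ∈ F.tail 1, (F.shiftF hw).RightMulForm x 1 b γ v 0 := by
  -- `w ↦ [w, x] - b w` is triangular on `f 1, f 2, …` with eigenvalues `1, 2, …`.
  obtain ⟨w, hw, hwx⟩ := spanTail.le_map_of_triangular (k := 1)
    (E := bracket.flip x - b • LinearMap.id) (μ := fun j => (j : ℂ)) F.f_eq_zero
    (fun j hj => Nat.cast_ne_zero.2 (by omega))
    (fun j _ => by simpa [add_smul, sub_sub] using A.f_x_sub_mem j) (neg_mem A.z_mem)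
  have hwx : bracket w x - b • w = -z := hwx
  exact ⟨w, hw, by simpa only [hwx, add_neg_cancel] using A.shiftF hw⟩

theorem exists_notMem_v_eq_smul (A : F.RightMulForm x a b γ v z) (hx : x ∉ N) :
    ∃ x' ∉ N, ∃ a₂ : ℂ, F.RightMulForm x' a b γ (a₂ • F.f 0) z := by
  obtain ⟨a₂, v', hv', rfl⟩ := spanTail.exists_smul_add A.v_mem
  have hT : F.tail 1 ≤ (F.tail 0).map (bracket F.e₁) := spanTail.le_iff.2 fun j hj => by
    obtain ⟨k, rfl⟩ := Nat.exists_eq_add_of_le' hj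
    exact ⟨F.f k, F.f_mem_tail_zero k, F.bracket_e₁_f k⟩
  obtain ⟨y, hy, rfl⟩ := hT hv'
  refine ⟨x + -y, (N.add_mem_iff_left (neg_mem (F.tail_le 0 hy))).not.2 hx, a₂, ?_⟩
  simpa only [map_neg, add_neg_cancel_right] using A.add_tail (neg_mem hy)

theorem exists_v_γ_eq_zero_of_ne {a₂ : ℂ} (A : F.RightMulForm x 1 b γ (a₂ • F.f 0) 0) :
    ∃ (G : G2Frame l N) (γ' a₂' : ℂ), G.RightMulForm x 1 b γ' (a₂' • G.f 0) 0 ∧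
      (b ≠ 1 → a₂' = 0) ∧ (b + l - 2 ≠ 0 → γ' = 0) := by
  have hu : -(a₂ / (b - 1)) • F.f 0 ∈ F.tail 0 := Submodule.smul_mem _ _ (F.f_mem_tail_zero 0)
  refine ⟨F.shiftE₁ hu (-(γ / (b + l - 2))), γ + -(γ / (b + l - 2)) * (b + l - 2),
    a₂ + -(a₂ / (b - 1)) * (b - 1), ?_, fun hb => ?_, fun hb => ?_⟩
  · convert A.shiftE₁ hu (-(γ / (b + l - 2))) using 1
    · ring
    · simp only [shiftE₁_f, map_smul, LinearMap.smul_apply, A.f_zero_x]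
      module
  · field_simp [sub_ne_zero.2 hb]
    ring
  · field_simp
    ring

theorem exists_normalForm_of_a_eq_zero (A : F.RightMulForm x 0 b γ v z) (hx : x ∉ N)
    (hb : b ≠ 0) : ∃ (G : G2Frame l N) (x' z' : R),
      x' ∉ N ∧ z' ∈ G.tail 2 ∧ G.RightMulForm x' 0 1 0 0 z' := by
  have A₁ := A.smul b⁻¹
  rw [mul_zero, inv_mul_cancel₀ hb] at A₁
  obtain ⟨x', hx', z', hz', A₂⟩ :=
    A₁.exists_notMem_z_mem_tail_two ((N.smul_mem_iff (inv_ne_zero hb)).not.2 hx)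
  obtain ⟨u, hu, A₃⟩ := A₂.exists_shiftE₁_v_eq_zero
  exact ⟨F.shiftE₁ hu _, x', z', hx', hz', A₃⟩

theorem exists_normalForm_of_a_ne_zero (A : F.RightMulForm x a b γ v z) (hx : x ∉ N)
    (ha : a ≠ 0) : ∃ (G : G2Frame l N) (x' : R) (b' γ' a₂ : ℂ),
      x' ∉ N ∧ G.RightMulForm x' 1 b' γ' (a₂ • G.f 0) 0 ∧ (b' ≠ 1 → a₂ = 0) ∧
      (b' + l - 2 ≠ 0 → γ' = 0) := by
  have A₁ := A.smul a⁻¹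
  rw [inv_mul_cancel₀ ha] at A₁
  obtain ⟨w, hw, A₂⟩ := A₁.exists_shiftF_z_eq_zero
  obtain ⟨x', hx', a₂, A₃⟩ :=
    A₂.exists_notMem_v_eq_smul ((N.smul_mem_iff (inv_ne_zero ha)).not.2 hx)
  obtain ⟨G, γ', a₂', A₄, ha₂, hγ⟩ := A₃.exists_v_γ_eq_zero_of_ne
  exact ⟨G, x', _, γ', a₂', hx', A₄, ha₂, hγ⟩

end RightMulForm

end NormalForm

section Tables

/-- The alternative of the classification: `e` and `x` multiply as in one of `R_1`, …, `R_5`. -/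
def HasTable (n : ℕ) (e : ℕ → R) (x : R) : Prop :=
  (∃ b : ℕ → ℂ, R1Table n b e x) ∨ (∃ a₂ : ℂ, R2Table n a₂ e x) ∨ (∃ γ : ℂ, R3Table n γ e x) ∨
    (∃ δ : ℂ, R4Table n δ e x) ∨
    (∃ b₂ : ℂ, b₂ ≠ 1 ∧ b₂ ≠ 5 - (n : ℂ) ∧ b₂ ≠ 3 - (n : ℂ) ∧ R5Table n b₂ e x)

/-- The family `e_1, …, e_n` with `n = l + 3`, indexed as in the tables. -/
def e : ℕ → R
  | 0 => 0
  | 1 => F.e₁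
  | k + 2 => if k = l + 1 then F.eₙ else F.f k

theorem e_one : F.e 1 = F.e₁ := rfl

theorem e_last : F.e (l + 3) = F.eₙ := if_pos rfl

theorem e_add_two {k : ℕ} (hk : k ≤ l) : F.e (k + 2) = F.f k := if_neg (by omega)

theorem e_eq_zero {i : ℕ} (hi : ¬(1 ≤ i ∧ i ≤ l + 3)) : F.e i = 0 := by
  rcases i with _ | _ | k
  · rfl
  · omega
  · grind [e, F.f_eq_zero]

theorem g2Table_e : G2Table (l + 3) F.e := by
  intro i hi j hj
  rcases eq_one_or_eq_last_or_eq_add_two hi with rfl | rfl | ⟨k, hk, rfl⟩ <;>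
    rcases eq_one_or_eq_last_or_eq_add_two hj with rfl | rfl | ⟨m, hm, rfl⟩ <;>
    grind [e, F.f_eq_zero, F.bracket_e₁_e₁, F.bracket_e₁_eₙ, F.bracket_eₙ_e₁, F.bracket_eₙ_eₙ,
      F.bracket_e₁_f, F.bracket_f_e₁, F.bracket_f_eₙ, F.bracket_eₙ_f, F.bracket_f_f]

theorem extensionTable_e {x q : R} {d : ℕ → R} (hneg : ∀ y ∈ N, bracket x y = -bracket y x)
    (h₁ : bracket F.e₁ x = d 1) (hₙ : bracket F.eₙ x = d (l + 3))
    (hf : ∀ k ≤ l, bracket (F.f k) x = d (k + 2)) (hq : bracket x x = q) :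
    ExtensionTable (l + 3) F.e x d q := by
  refine ⟨F.g2Table_e, fun i hi => ?_, hq⟩
  rcases eq_one_or_eq_last_or_eq_add_two hi with rfl | rfl | ⟨k, hk, rfl⟩
  · exact ⟨h₁, by rw [e_one, hneg _ F.e₁_mem, h₁]⟩
  · rw [e_last]
    exact ⟨hₙ, by rw [hneg _ F.eₙ_mem, hₙ]⟩
  · rw [F.e_add_two hk]
    exact ⟨hf k hk, by rw [hneg _ (F.f_mem k), hf k hk]⟩

namespace RightMulForm

variable {F} {x : R} {b γ a₂ : ℂ} {z : R} (hl : 2 ≤ l) (hI : IsIdeal N) (hN : IsCoatom N)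
include hl hI hN

theorem exists_r1Table (A : F.RightMulForm x 0 1 0 0 z) (hz : z ∈ F.tail 2) :
    ∃ b : ℕ → ℂ, R1Table (l + 3) b F.e x := by
  obtain ⟨c, rfl⟩ := spanTail.exists_eq_sum F.f_eq_zero hz
  refine ⟨fun j => c (j - 2), F.extensionTable_e (fun y => A.bracket_x_eq_neg hl hI hN (by simp))
    (by simp [A.e₁_x]) (by simp [A.eₙ_x]) (fun k hk => ?_)
    (A.bracket_self_eq_zero hl hI hN (by simp))⟩
  rw [A.f_x, if_pos (by omega), F.e_add_two hk, map_sum, mul_zero, add_zero, one_smul]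
  congr 1
  have hIcc : Finset.Icc (k + 2 + 2) (l + 3 - 1) =
      (Finset.Icc 2 (l - k)).map (addRightEmbedding (k + 2)) := by
    rw [Finset.map_add_right_Icc]
    congr 1 <;> omega
  rw [hIcc, Finset.sum_map]
  refine (Finset.sum_subset_zero_on_sdiff (Finset.Icc_subset_Icc_right (by omega))
    (fun t ht => ?_) fun t ht => ?_).symm
  · rw [map_smul, F.bracket_e₁_pow_f, F.f_eq_zero _ (by grind), smul_zero]
  · rw [addRightEmbedding_apply, ← add_assoc, F.e_add_two (by grind), map_smul,
      F.bracket_e₁_pow_f]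
    simp

theorem extensionTable_of_a_eq_one (A : F.RightMulForm x 1 b γ (a₂ • F.f 0) 0) :
    ExtensionTable (l + 3) F.e x
      (fun i => if i = 1 then F.e 1 + a₂ • F.e 2
        else if i = l + 3 then -(a₂ • F.e 3) + γ • F.e (l + 2) + (2 : ℂ) • F.e (l + 3)
        else ((i : ℂ) - 2 + b) • F.e i) (bracket x x) := by
  refine F.extensionTable_e (fun y => A.bracket_x_eq_neg hl hI hN (by simp)) ?_ ?_
    (fun k hk => ?_) rfl
  · rw [if_pos rfl, A.e₁_x, e_one, F.e_add_two l.zero_le, one_smul]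
  · rw [if_neg (by omega), if_pos rfl, A.eₙ_x, e_last, F.e_add_two le_rfl, map_smul,
      F.bracket_e₁_f, F.e_add_two (k := 1) (by omega)]
    module
  · rw [if_neg (by omega), if_neg (by omega), A.f_x, F.e_add_two hk, map_zero]
    push_cast
    module

theorem extensionTable_of_v_eq_zero (A : F.RightMulForm x 1 b γ 0 0) :
    ExtensionTable (l + 3) F.e x
      (fun i => if i = 1 then F.e 1
        else if i = l + 3 then γ • F.e (l + 2) + (2 : ℂ) • F.e (l + 3)
        else ((i : ℂ) - 2 + b) • F.e i) (bracket x x) := by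
  have A₀ : F.RightMulForm x 1 b γ ((0 : ℂ) • F.f 0) 0 := by rwa [zero_smul]
  simpa using A₀.extensionTable_of_a_eq_one hl hI hN

theorem r2Table (A : F.RightMulForm x 1 1 0 (a₂ • F.f 0) 0) : R2Table (l + 3) a₂ F.e x := by
  have hx : bracket x x = 0 := A.bracket_self_eq_zero hl hI hN (by
    rw [mul_one, add_comm]; exact Nat.cast_add_one_ne_zero l)
  have hd (i : ℕ) : (i : ℂ) - 2 + 1 = i - 1 := by ring
  simpa [R2Table, hx, hd] using A.extensionTable_of_a_eq_one hl hI hN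

theorem r3Table (A : F.RightMulForm x 1 (2 - l) γ 0 0) : R3Table (l + 3) γ F.e x := by
  have hx : bracket x x = 0 := A.bracket_self_eq_zero hl hI hN (by simp)
  have hd (i : ℕ) : (i : ℂ) - 2 + (2 - l) = i - l := by ring
  simpa [R3Table, hx, hd] using A.extensionTable_of_v_eq_zero hl hI hN

theorem exists_r4Table (A : F.RightMulForm x 1 (-l) 0 0 0) : ∃ δ : ℂ, R4Table (l + 3) δ F.e x := by
  obtain ⟨δ, hx, -⟩ := A.exists_bracket_self_eq hl hI hN
  have hd (i : ℕ) : (i : ℂ) - 2 + -l = i + 1 - (l + 3) := by ring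
  exact ⟨δ, by simpa [R4Table, hx, hd, F.e_add_two] using A.extensionTable_of_v_eq_zero hl hI hN⟩

theorem r5Table (A : F.RightMulForm x 1 b 0 0 0) (hb : b ≠ -l) : R5Table (l + 3) b F.e x := by
  have hx : bracket x x = 0 :=
    A.bracket_self_eq_zero hl hI hN fun h => hb (by linear_combination h)
  simpa [R5Table, hx] using A.extensionTable_of_v_eq_zero hl hI hN

theorem hasTable_of_a_eq_one (hl₁ : l ≠ 1) (A : F.RightMulForm x 1 b γ (a₂ • F.f 0) 0)
    (ha₂ : b ≠ 1 → a₂ = 0) (hγ : b + l - 2 ≠ 0 → γ = 0) : HasTable (l + 3) F.e x := by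
  by_cases h₂ : b = 1
  · have hlb : b + l - 2 ≠ 0 := fun h => hl₁ <| by
      rw [h₂] at h
      exact_mod_cast (by linear_combination h : (l : ℂ) = 1)
    rw [h₂, hγ hlb] at A
    exact .inr (.inl ⟨a₂, A.r2Table hl hI hN⟩)
  rw [ha₂ h₂, zero_smul] at A
  by_cases h₃ : b = 2 - l
  · rw [h₃] at A
    exact .inr (.inr (.inl ⟨γ, A.r3Table hl hI hN⟩))
  rw [hγ fun h => h₃ (by linear_combination h)] at A
  by_cases h₄ : b = -l
  · rw [h₄] at A
    exact .inr (.inr (.inr (.inl (A.exists_r4Table hl hI hN))))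
  refine .inr (.inr (.inr (.inr ⟨b, h₂, fun h => h₃ ?_, fun h => h₄ ?_, A.r5Table hl hI hN h₄⟩)))
  all_goals
    rw [h]
    push_cast
    ring

end RightMulForm

end Tables

theorem exists_hasTable (F : G2Frame l N) (hl : 3 ≤ l) (hN : IsNilradical N) (hNc : IsCoatom N)
    {x : R} (hx : x ∉ N) : ∃ (G : G2Frame l N) (x' : R), x' ∉ N ∧ HasTable (l + 3) G.e x' := by
  have hI := hN.prop.1
  have hl₂ : 2 ≤ l := by omega
  obtain ⟨a, b, γ, v, z, A⟩ := F.exists_rightMulForm hl fun y hy => (hI y hy x).1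
  rcases eq_or_ne a 0 with rfl | ha
  · have hb : b ≠ 0 := by
      rintro rfl
      exact hN.not_nilpotent_top hNc.1 (A.nilpotent_top hNc hx hI)
    obtain ⟨G, x', z', hx', hz', A'⟩ := A.exists_normalForm_of_a_eq_zero hx hb
    exact ⟨G, x', hx', .inl (A'.exists_r1Table hl₂ hI hNc hz')⟩
  · obtain ⟨G, x', b', γ', a₂, hx', A', ha₂, hγ'⟩ := A.exists_normalForm_of_a_ne_zero hx ha
    exact ⟨G, x', hx', A'.hasTable_of_a_eq_one hl₂ hI hNc (by omega) ha₂ hγ'⟩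

section Basis

theorem span_e_eq_top (hN : IsCoatom N) {x : R} (hx : x ∉ N) :
    Submodule.span ℂ
      (Set.range (Sum.elim (fun k : Fin (l + 3) => F.e (k + 1)) fun _ : Unit => x)) = ⊤ := by
  set S := Submodule.span ℂ
    (Set.range (Sum.elim (fun k : Fin (l + 3) => F.e (k + 1)) fun _ : Unit => x))
  have he {i : ℕ} (hi : 1 ≤ i) (hil : i ≤ l + 3) : F.e i ∈ S :=
    Submodule.subset_span ⟨Sum.inl ⟨i - 1, by omega⟩, by simp [Nat.sub_add_cancel hi]⟩
  have hf : F.tail 0 ≤ S := spanTail.le_iff.2 fun k _ => by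
    by_cases hk : k ≤ l
    · exact F.e_add_two hk ▸ he (by omega) (by omega)
    · rw [F.f_eq_zero k (by omega)]
      exact S.zero_mem
  have hNS : N ≤ S := F.le_span.trans <| sup_le (Submodule.span_le.2 <|
    Set.pair_subset (he le_rfl (by omega)) (F.e_last ▸ he (by omega) le_rfl)) hf
  exact hN.2 S (lt_of_le_of_ne hNS fun h => hx (h ▸ Submodule.subset_span ⟨Sum.inr (), rfl⟩))

theorem exists_basis (hN : IsCoatom N) {x : R} (hx : x ∉ N) (hR : Module.finrank ℂ R = l + 4) :
    ∃ B : Module.Basis (Fin (l + 3) ⊕ Unit) ℂ R,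
      oneIndexed (fun k => B (Sum.inl k)) = F.e ∧ B (Sum.inr ()) = x := by
  refine ⟨basisOfTopLeSpanOfCardEqFinrank _ (F.span_e_eq_top hN hx).ge (by simp [hR]), ?_, by simp⟩
  funext i
  by_cases hi : 1 ≤ i ∧ i ≤ l + 3
  · simp [oneIndexed, hi]
  · simp [oneIndexed, hi, F.e_eq_zero hi]

end Basis

end G2Frame

section OfIsG2

variable {l : ℕ} {N : Submodule ℂ R}

theorem G2Table.nonempty_g2Frame {e : ℕ → R} (h : G2Table (l + 3) e)
    (hN : Submodule.span ℂ (e '' Set.Icc 1 (l + 3)) = N) (h₀ : e (l + 2) ≠ 0) :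
    Nonempty (G2Frame l N) := by
  have hmem {i : ℕ} (hi : 1 ≤ i) (hil : i ≤ l + 3) : e i ∈ N :=
    hN ▸ Submodule.subset_span ⟨i, ⟨hi, hil⟩, rfl⟩
  refine ⟨{
    e₁ := e 1
    eₙ := e (l + 3)
    f := fun k => if k ≤ l then e (k + 2) else 0
    e₁_mem := hmem le_rfl (by omega)
    eₙ_mem := hmem (by omega) le_rfl
    f_mem := fun k => by grind [N.zero_mem]
    le_span := ?_
    f_last_ne_zero := by simpa using h₀
    f_eq_zero := by grind
    bracket_e₁_e₁ := ?_
    bracket_e₁_eₙ := ?_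
    bracket_eₙ_e₁ := ?_
    bracket_eₙ_eₙ := ?_
    bracket_e₁_f := ?_
    bracket_f_e₁ := ?_
    bracket_f_eₙ := ?_
    bracket_eₙ_f := ?_
    bracket_f_f := ?_ }⟩
  · rw [← hN, Submodule.span_le]
    rintro _ ⟨i, hi, rfl⟩
    rcases eq_one_or_eq_last_or_eq_add_two (Finset.mem_Icc.2 hi) with rfl | rfl | ⟨k, hk, rfl⟩
    · exact Submodule.mem_sup_left (Submodule.subset_span (by simp))
    · exact Submodule.mem_sup_left (Submodule.subset_span (by simp))
    · have hf := spanTail.apply_mem (K := ℂ)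
        (f := fun k => if k ≤ l then e (k + 2) else 0) k.zero_le
      exact Submodule.mem_sup_right (by simpa [hk] using hf)
  all_goals
    simp only [G2Table, Finset.mem_Icc] at h
    grind [LinearMap.zero_apply]

theorem IsG2.nonempty_g2Frame (h : IsG2 (l + 3) N) : Nonempty (G2Frame l N) := by
  obtain ⟨v, hv⟩ := h
  refine hv.nonempty_g2Frame ?_ ?_
  · have hr : oneIndexed (fun k => (v k : R)) '' Set.Icc 1 (l + 3) = N.subtype '' Set.range v := by
      ext y
      constructor
      · rintro ⟨i, hi, rfl⟩
        exact ⟨_, ⟨⟨i - 1, by grind⟩, rfl⟩, by simp [oneIndexed, hi.1, hi.2]⟩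
      · rintro ⟨_, ⟨k, rfl⟩, rfl⟩
        exact ⟨k + 1, by grind, by simp [oneIndexed, Nat.succ_le_iff.2 k.2]⟩
    rw [hr, Submodule.span_image, v.span_eq, Submodule.map_subtype_top]
  · simpa [oneIndexed] using v.ne_zero _

theorem IsG2.finrank_eq_add_one {n : ℕ} {Q : Submodule ℂ R} (h : IsG2 n N) (hNQ : IsCompl N Q)
    (hQ : Module.finrank ℂ Q = 1) : Module.finrank ℂ R = n + 1 := by
  obtain ⟨v, -⟩ := h
  have := Module.Finite.of_basis v
  have := Module.finite_of_finrank_eq_succ hQ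
  rw [← (Submodule.prodEquivOfIsCompl N Q hNQ).finrank_eq, Module.finrank_prod, hQ,
    Module.finrank_eq_card_basis v, Fintype.card_fin]

end OfIsG2

end Frame

end LeibnizAlgebra

theorem mainTheorem7 (n : ℕ) (hn : 6 ≤ n)
    (R : Type*) [AddCommGroup R] [Module ℂ R] [LeibnizAlgebra R]
    (hsol : LeibnizAlgebra.Solvable R)
    (N Q : Submodule ℂ R)
    (hN : LeibnizAlgebra.IsNilradical N) (hg : LeibnizAlgebra.IsG2 n N)
    (hNQ : IsCompl N Q) (hQ : Module.finrank ℂ Q = 1) :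
    ∃ (B : Module.Basis (Fin n ⊕ Unit) ℂ R) (e : ℕ → R) (x : R),
      e = LeibnizAlgebra.oneIndexed (fun k => B (Sum.inl k)) ∧ x = B (Sum.inr ()) ∧
      ((∃ b : ℕ → ℂ, LeibnizAlgebra.R1Table n b e x) ∨
       (∃ a₂ : ℂ, LeibnizAlgebra.R2Table n a₂ e x) ∨
       (∃ γ : ℂ, LeibnizAlgebra.R3Table n γ e x) ∨
       (∃ δ : ℂ, LeibnizAlgebra.R4Table n δ e x) ∨
       (∃ b₂ : ℂ, b₂ ≠ 1 ∧ b₂ ≠ 5 - (n : ℂ) ∧ b₂ ≠ 3 - (n : ℂ) ∧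
          LeibnizAlgebra.R5Table n b₂ e x)) := by
  obtain ⟨l, rfl⟩ := Nat.exists_eq_add_of_le' (show 3 ≤ n by omega)
  have hNc : IsCoatom N := hNQ.isCoatom_iff_isAtom.2 (Submodule.isAtom_iff_finrank_eq_one.2 hQ)
  have hR := hg.finrank_eq_add_one hNQ hQ
  obtain ⟨x₀, -, hx₀⟩ := SetLike.exists_of_lt hNc.lt_top
  obtain ⟨F₀⟩ := hg.nonempty_g2Frame
  obtain ⟨F, x, hx, h⟩ := F₀.exists_hasTable (by omega) hN hNc hx₀
  obtain ⟨B, hB, hBx⟩ := F.exists_basis hNc hx hR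
  exact ⟨B, F.e, x, hB.symm, hBx.symm, h⟩
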